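/- **Setting.** An input $Q$ consists of a finite set $P$ of $n$ pages, a cache size $k$ with $1\le k<n$, a sequence $p_1,\dots,p_T$ of requests in which every page of $P$ occurs, weights $0<w_p\le 1$, and, for every page $p$, a sequence of samples $w_p^1,w_p^2,\ldots\in(0,1]$ (an arbitrary realization; in the stochastic model these are independent samples from a distribution on $(0,1]$ with mean $w_p$). A fractional solution maintains anti-servers $y_p\in[0,1]$ (the missing fraction of $p$), initially all $1$; after each request to $p$ one must have $y_p=0$ and $\sum_{p'\in P}y_{p'}\ge n-k$. Increasing $y_p$ by $\varepsilon$ (evicting) costs $\varepsilon w_p$; decreasing it is free. Let $\mathrm{OPT}(Q)$ be the minimum eviction cost of an offline integral solution (a sequence of caches of at most $k$ pages, initially empty, that contain each requested page when it is requested), and $\mathrm{OPT}_{\mathrm{frac}}(Q)$ the minimum cost of an offline fractional solution. **Confidence bounds.** After one sample of $p$, $\mathrm{LCB}_{p,1}=\frac{1}{2n^2T}w_p^1$ and $\mathrm{UCB}_{p,1}=1$. For $i\ge2$, with $\bar w_{p,i}=\frac1i\sum_{j\le i}w_p^j$ and $\epsilon_{p,i}=\sqrt{\log(4n^3T^3)/(2i)}$,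 set $\mathrm{LCB}_{p,i}=\max\{\mathrm{LCB}_{p,i-1},\bar w_{p,i}-\epsilon_{p,i}\}$ and $\mathrm{UCB}_{p,i}=\min\{\mathrm{UCB}_{p,i-1},\bar w_{p,i}+\epsilon_{p,i}\}$. **Algorithm $\mathrm{ONF}$** (with $\eta=1/k$). When $q$ is requested, set $y_q\leftarrow0$, and take the first sample of $q$ if this is its first request. Then, while $\sum_p y_p<n-k$, continuously increase all $y_p$ with $p\ne q$ and $y_p<1$ simultaneously, at rates proportional to $(y_p+\eta)/\mathrm{LCB}_p$, where $\mathrm{LCB}_p$ is the current lower confidence bound; whenever the total fraction of $p$ evicted so far reaches a positive integer, take the next sample of $p$ and update its confidence bounds. Let $\mathrm{ONF}(Q)$ be the eviction cost of this algorithm with respect to the weights $w_p$, and $\overline{\mathrm{ONF}}(Q)$ its cost when eviction of $p$ is charged at the current $\mathrm{UCB}_p$ instead of $w_p$. **Lemma.** There is an absolute constant $C>0$ such that for every input $Q$ for which the good event holds, i.e. $\mathrm{LCB}_{p,i}\le w_p\le\mathrm{UCB}_{p,i}$ for every page $p$ and every $i\geq 1$ up to the final number of samples of $p$ taken by the algorithm,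 $$\mathrm{ONF}(Q)\;\le\;\overline{\mathrm{ONF}}(Q)\;\le\; C\log(1+k)\cdot\mathrm{OPT}(Q)+C\sqrt{nT}\,\log(nT),$$ and the second inequality also holds with $\mathrm{OPT}_{\mathrm{frac}}(Q)$ in place of $\mathrm{OPT}(Q)$. -/

import Mathlib

noncomputable section

namespace FracPaging

/-- An input for fractional online weighted paging with unknown weights, together with the
realization of the samples. `P` is the (finite) set of requested pages, `k` the cache size, `T` the
number of requests; the `t`-th request (`0 ≤ t < T`, zero-based) is `req t`. The value `sample p i`
(`1 ≤ i`) is the `i`-th sample of the page `p`; values of `req` from `T` on and `sample p 0`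
are never used. -/
structure Input (P : Type*) [Fintype P] where
  k : ℕ
  T : ℕ
  req : ℕ → P
  w : P → ℝ
  sample : P → ℕ → ℝ
  one_le_k : 1 ≤ k
  k_lt : k < Fintype.card P
  requested : ∀ p, ∃ t < T, req t = p
  w_mem : ∀ p, w p ∈ Set.Ioc (0 : ℝ) 1
  sample_mem : ∀ p i, sample p i ∈ Set.Ioc (0 : ℝ) 1

namespace Input

variable {P : Type*} [Fintype P] (Q : Input P)

/-- The number `n` of pages. -/
def n (_Q : Input P) : ℕ := Fintype.card P

/-! ### Offline optimum -/

/-- `C t` is the cache content after the first `t` requests; the cache is initially empty. -/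
def IsCacheSchedule (C : ℕ → Finset P) : Prop :=
  C 0 = ∅ ∧ ∀ t < Q.T, (C (t + 1)).card ≤ Q.k ∧ Q.req t ∈ C (t + 1)

/-- Total weight of the evictions of a cache schedule. -/
def scheduleCost [DecidableEq P] (C : ℕ → Finset P) : ℝ :=
  ∑ t ∈ Finset.range Q.T, ∑ p ∈ C t \ C (t + 1), Q.w p

/-- The cost of an optimal offline (integral) solution. -/
def opt [DecidableEq P] : ℝ :=
  sInf {c | ∃ C : ℕ → Finset P, Q.IsCacheSchedule C ∧ c = Q.scheduleCost C}

/-- `z t p` is the anti-server (missing fraction) at `p` after the first `t` requests. -/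
def IsFracSchedule (z : ℕ → P → ℝ) : Prop :=
  (∀ p, z 0 p = 1) ∧
  ∀ t < Q.T, (∀ p, z (t + 1) p ∈ Set.Icc (0 : ℝ) 1) ∧
    (Q.n : ℝ) - Q.k ≤ ∑ p, z (t + 1) p ∧ z (t + 1) (Q.req t) = 0

/-- Total cost of the increases of the anti-servers. -/
def fracScheduleCost (z : ℕ → P → ℝ) : ℝ :=
  ∑ t ∈ Finset.range Q.T, ∑ p, Q.w p * max 0 (z (t + 1) p - z t p)

/-- The cost of an optimal offline fractional solution. -/
def fracOpt : ℝ :=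
  sInf {c | ∃ z : ℕ → P → ℝ, Q.IsFracSchedule z ∧ c = Q.fracScheduleCost z}

/-! ### Confidence bounds -/

/-- Average of the first `i` samples of `p`. -/
def mean (p : P) (i : ℕ) : ℝ := (∑ j ∈ Finset.Icc 1 i, Q.sample p j) / i

/-- Confidence radius after `i` samples. -/
def radius (i : ℕ) : ℝ :=
  Real.sqrt (Real.log (4 * (Q.n : ℝ) ^ 3 * (Q.T : ℝ) ^ 3) / (2 * i))

/-- Lower confidence bound of `p` after `i` samples (not meaningful for `i = 0`). -/
def lcb (p : P) : ℕ → ℝ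
  | 0 => 0
  | 1 => 1 / (2 * (Q.n : ℝ) ^ 2 * Q.T) * Q.sample p 1
  | i + 2 => max (lcb p (i + 1)) (Q.mean p (i + 2) - Q.radius (i + 2))

/-- Upper confidence bound of `p` after `i` samples (not meaningful for `i = 0`). -/
def ucb (p : P) : ℕ → ℝ
  | 0 => 1
  | 1 => 1
  | i + 2 => min (ucb p (i + 1)) (Q.mean p (i + 2) + Q.radius (i + 2))

/-! ### The fractional algorithm -/

/-- `η = 1 / k`. -/
def eta : ℝ := 1 / (Q.k : ℝ)

/-- State of the algorithm: anti-server `y p`, total evicted fraction `m p` and number of samples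
`N p` of each page, the cost so far with respect to the true weights (`cost`), and the cost so far
when evicting from `p` is charged at the current upper confidence bound (`costUCB`). -/
structure State (P : Type*) where
  y : P → ℝ
  m : P → ℝ
  N : P → ℕ
  cost : ℝ
  costUCB : ℝ

/-- Initially the cache is empty and no page has been sampled. -/
def init : State P where
  y := fun _ => 1
  m := fun _ => 0
  N := fun _ => 0
  cost := 0
  costUCB := 0

/-- Enough anti-server: at most `k` units of server are in the cache. -/
def Feasible (S : State P) : Prop := (Q.n : ℝ) - Q.k ≤ ∑ p, S.y p

variable [DecidableEq P]

/-- While the request for `q` is handled, anti-server is added to the pages `p ≠ q` with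
`y p < 1`. -/
def Active (q : P) (S : State P) (p : P) : Prop := p ≠ q ∧ S.y p < 1

instance (q : P) (S : State P) (p : P) : Decidable (Active q S p) :=
  inferInstanceAs (Decidable (p ≠ q ∧ S.y p < 1))

/-- The anti-servers after continuously evicting for `s` units of time, starting at `S`: every
active `y p` grows at rate `(y p + η) / LCB p` (see `hasDerivAt_flowY`), all others are fixed. -/
def flowY (q : P) (S : State P) (s : ℝ) (p : P) : ℝ :=
  if Active q S p then (S.y p + Q.eta) * Real.exp (s / Q.lcb p (S.N p)) - Q.eta else S.y p

theorem flowY_zero (q : P) (S : State P) (p : P) : Q.flowY q S 0 p = S.y p := by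
  simp [flowY]

theorem hasDerivAt_flowY (q : P) (S : State P) (s : ℝ) (p : P)
    (hp : Active q S p) :
    HasDerivAt (fun u => Q.flowY q S u p)
      ((Q.flowY q S s p + Q.eta) / Q.lcb p (S.N p)) s := by
  have e : ∀ u, Q.flowY q S u p =
      (S.y p + Q.eta) * Real.exp (u / Q.lcb p (S.N p)) - Q.eta := fun u => if_pos hp
  simp only [e]
  have h := ((((hasDerivAt_id s).div_const (Q.lcb p (S.N p))).exp).const_mul
    (S.y p + Q.eta)).sub_const Q.eta
  refine h.congr_deriv ?_
  simp only [id]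
  ring

/-- The total evicted fractions after continuously evicting for `s` units of time. -/
def flowM (q : P) (S : State P) (s : ℝ) (p : P) : ℝ :=
  S.m p + (Q.flowY q S s p - S.y p)

/-- The first time at which feasibility is reached, or the anti-server of an active page reaches
`1`, or the total evicted fraction of an active page reaches the next integer, which is its current
number of samples. -/
def stopTime (q : P) (S : State P) : ℝ :=
  sInf {s | 0 ≤ s ∧ ((Q.n : ℝ) - Q.k ≤ ∑ p, Q.flowY q S s p ∨
    ∃ p, Active q S p ∧ (1 ≤ Q.flowY q S s p ∨ (S.N p : ℝ) ≤ Q.flowM q S s p))}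

/-- One phase of continuous eviction: evict until `stopTime`; then every page whose total evicted
fraction has reached an integer is sampled (so that its confidence bounds are updated). During a
phase the confidence bounds are constant. -/
def phase (q : P) (S : State P) : State P where
  y := Q.flowY q S (Q.stopTime q S)
  m := Q.flowM q S (Q.stopTime q S)
  N := fun p =>
    if Active q S p ∧ (S.N p : ℝ) ≤ Q.flowM q S (Q.stopTime q S) p then S.N p + 1 else S.N p
  cost := S.cost + ∑ p, Q.w p * (Q.flowY q S (Q.stopTime q S) p - S.y p)
  costUCB := S.costUCB +
    ∑ p, Q.ucb p (S.N p) * (Q.flowY q S (Q.stopTime q S) p - S.y p)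

/-- Fetch the requested page completely, and sample it if this is its first request. Fetching is
free. -/
def fetch (q : P) (S : State P) : State P :=
  { S with
    y := Function.update S.y q 0
    N := if S.N q = 0 then Function.update S.N q 1 else S.N }

/-- Handle a request for `q`: fetch `q`, then perform phases of continuous eviction until the state
is feasible. -/
def serve (q : P) (S : State P) : State P :=
  (Q.phase q)^[sInf {j : ℕ | Q.Feasible ((Q.phase q)^[j] (fetch q S))}] (fetch q S)

/-- The state of the algorithm after the first `t` requests. -/
def run : ℕ → State P
  | 0 => init
  | t + 1 => Q.serve (Q.req t) (run t)

/-- The cost of the algorithm on the input. -/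
def onf : ℝ := (Q.run Q.T).cost

/-- The cost of the algorithm when evicting from `p` is charged at the current upper confidence
bound of `p`. -/
def onfUCB : ℝ := (Q.run Q.T).costUCB

/-- The good event: throughout the run, i.e. after each of the samples of `p` that the algorithm
receives, the confidence bounds of `p` enclose its weight. -/
def GoodEvent : Prop :=
  ∀ p i, 1 ≤ i → i ≤ (Q.run Q.T).N p → Q.lcb p i ≤ Q.w p ∧ Q.w p ≤ Q.ucb p i

end Input

end FracPaging

end

set_option linter.unusedSectionVars false

namespace FracPaging

namespace Input

variable {P : Type*} [Fintype P] (Q : Input P)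

/-! ### Parameters -/

/-! A potential argument against an arbitrary fractional schedule `z`. The potential sums `z p * LCB
p * log ((1 + η) / (y p + η))`; as `η = 1 / k`, the logarithm lies in `[0, log (1 + k)]`. The
evicting rates are chosen so that each active factor `LCB p * log (...)` falls at unit speed
(`log_ratio_flowY`), while the eviction cost measured in `LCB` grows at speed `∑ (y p + η)` over the
active pages. Infeasibility bounds this sum by twice the active mass of `z` (`sum_active_le`), so
twice the potential pays for the `LCB` cost.

Two corrections make `energy` nonincreasing while a request is served. A rising `LCB p` raises the
potential by at most `log (1 + k)` times its growth, which telescopes to at most `n * log (1 + k)`.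
Charging `UCB` instead of `LCB` costs the interval width, of order `1 / √N` with `m ≤ N`, which
integrates to `2 * √m` per page; Cauchy–Schwarz and total eviction at most `T` give `√(nT)`.

Only moves of `z` increase the energy, by at most `2 * log (1 + k)` times their cost
(`energy_move_le`). Summing over the requests bounds `onfUCB` by the cost of any fractional
schedule, and cache schedules are a special case. -/

theorem two_le_n : 2 ≤ Q.n := by
  have h1 := Q.one_le_k
  have h2 := Q.k_lt
  unfold n
  omega

theorem n_le_T : Q.n ≤ Q.T := by
  classical
  have h : (Finset.univ : Finset P) ⊆ (Finset.range Q.T).image Q.req := by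
    intro p _
    obtain ⟨t, ht, rfl⟩ := Q.requested p
    exact Finset.mem_image_of_mem _ (Finset.mem_range.2 ht)
  calc Q.n = (Finset.univ : Finset P).card := rfl
    _ ≤ ((Finset.range Q.T).image Q.req).card := Finset.card_le_card h
    _ ≤ Q.T := by simpa using Finset.card_image_le (s := Finset.range Q.T) (f := Q.req)

theorem eta_pos : 0 < Q.eta := by
  have : (0 : ℝ) < Q.k := by exact_mod_cast Q.one_le_k
  unfold eta
  positivity

theorem one_add_eta_div_eta : (1 + Q.eta) / Q.eta = 1 + Q.k := by
  have : (0 : ℝ) < Q.k := by exact_mod_cast Q.one_le_k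
  unfold eta
  field_simp
  ring

theorem log_one_add_k_nonneg : 0 ≤ Real.log (1 + (Q.k : ℝ)) :=
  Real.log_nonneg (by linarith [(Nat.cast_nonneg Q.k : (0 : ℝ) ≤ Q.k)])

/-- Every admissible logarithmic factor of the potential is at most `log (1 + k)`. -/
theorem log_ratio_le {y : ℝ} (hy : 0 ≤ y) :
    Real.log ((1 + Q.eta) / (y + Q.eta)) ≤ Real.log (1 + Q.k) := by
  have h := Q.eta_pos
  rw [← Q.one_add_eta_div_eta]
  apply Real.log_le_log (by positivity)
  exact div_le_div_of_nonneg_left (by linarith) h (by linarith)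

theorem log_ratio_nonneg {y : ℝ} (hy : 0 ≤ y) (hy1 : y ≤ 1) :
    0 ≤ Real.log ((1 + Q.eta) / (y + Q.eta)) := by
  have h := Q.eta_pos
  apply Real.log_nonneg
  rw [le_div_iff₀ (by linarith)]
  linarith

/-! ### Confidence bounds -/

theorem lcb_one_pos (p : P) : 0 < Q.lcb p 1 := by
  have h1 : (0 : ℝ) < Q.n := by exact_mod_cast (by have := Q.two_le_n; omega : 0 < Q.n)
  have h2 : (0 : ℝ) < Q.T := by
    exact_mod_cast (by have := Q.two_le_n; have := Q.n_le_T; omega : 0 < Q.T)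
  have h3 := (Q.sample_mem p 1).1
  simp only [lcb]
  positivity

theorem lcb_mono (p : P) : Monotone (Q.lcb p) := by
  refine monotone_nat_of_le_succ fun i => ?_
  match i with
  | 0 => exact (Q.lcb_one_pos p).le
  | i + 1 => exact le_max_left _ _

theorem ucb_anti (p : P) : Antitone (Q.ucb p) := by
  refine antitone_nat_of_succ_le fun i => ?_
  match i with
  | 0 => simp [ucb]
  | i + 1 => exact min_le_left _ _

theorem lcb_pos (p : P) {i : ℕ} (hi : 1 ≤ i) : 0 < Q.lcb p i :=
  (Q.lcb_one_pos p).trans_le (Q.lcb_mono p hi)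

theorem lcb_nonneg (p : P) (i : ℕ) : 0 ≤ Q.lcb p i := Q.lcb_mono p (Nat.zero_le i)

/-- The factor of the width of the confidence intervals. -/
noncomputable def widthConst : ℝ := Real.sqrt (2 * Real.log (4 * (Q.n : ℝ) ^ 3 * (Q.T : ℝ) ^ 3))

theorem four_le_n_mul_T : (4 : ℝ) ≤ (Q.n : ℝ) * Q.T := by
  exact_mod_cast (Nat.mul_le_mul Q.two_le_n (Q.two_le_n.trans Q.n_le_T) : 2 * 2 ≤ Q.n * Q.T)

theorem one_le_log_n_mul_T : 1 ≤ Real.log ((Q.n : ℝ) * Q.T) := by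
  have h := Q.four_le_n_mul_T
  rw [Real.le_log_iff_exp_le (by linarith)]
  linarith [Real.exp_one_lt_d9]

theorem log_le_log_argument :
    Real.log ((Q.n : ℝ) * Q.T) ≤ Real.log (4 * (Q.n : ℝ) ^ 3 * (Q.T : ℝ) ^ 3) := by
  have h := Q.four_le_n_mul_T
  apply Real.log_le_log (by linarith)
  have : 4 * (Q.n : ℝ) ^ 3 * (Q.T : ℝ) ^ 3 = 4 * ((Q.n : ℝ) * Q.T) ^ 3 := by ring
  rw [this]
  have : (1 : ℝ) ≤ ((Q.n : ℝ) * Q.T) ^ 2 := one_le_pow₀ (by linarith)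
  nlinarith

theorem log_argument_le :
    Real.log (4 * (Q.n : ℝ) ^ 3 * (Q.T : ℝ) ^ 3) ≤ 4 * Real.log ((Q.n : ℝ) * Q.T) := by
  have h := Q.four_le_n_mul_T
  have e : 4 * Real.log ((Q.n : ℝ) * Q.T) = Real.log (((Q.n : ℝ) * Q.T) ^ 4) := by
    rw [Real.log_pow]; norm_num
  have e' : 4 * (Q.n : ℝ) ^ 3 * (Q.T : ℝ) ^ 3 = 4 * ((Q.n : ℝ) * Q.T) ^ 3 := by ring
  rw [e, e']
  have : (0 : ℝ) < ((Q.n : ℝ) * Q.T) ^ 3 := by positivity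
  apply Real.log_le_log (by linarith)
  rw [pow_succ _ 3]
  nlinarith

theorem one_le_widthConst : 1 ≤ Q.widthConst := by
  rw [widthConst, Real.one_le_sqrt]
  linarith [Q.one_le_log_n_mul_T, Q.log_le_log_argument]

theorem widthConst_le : Q.widthConst ≤ 3 * Real.log ((Q.n : ℝ) * Q.T) := by
  have h := Q.one_le_log_n_mul_T
  rw [widthConst, Real.sqrt_le_left (by linarith)]
  -- With `x = log (nT) ≥ 1`, the radicand is at most `8 * x ≤ (3 * x) ^ 2`.
  nlinarith [Q.log_argument_le]

theorem two_mul_radius (i : ℕ) : 2 * Q.radius i = Q.widthConst / Real.sqrt i := by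
  rw [radius, widthConst, ← Real.sqrt_div' _ (Nat.cast_nonneg i)]
  rw [show (2 : ℝ) = Real.sqrt (2 ^ 2) by simp, ← Real.sqrt_mul (by positivity)]
  congr 1
  rw [Real.sqrt_sq (by norm_num)]
  by_cases hi : (i : ℝ) = 0
  · simp [hi]
  · field_simp

/-- From the second sample on, the interval lies within one radius of the current mean on either
side; after one sample its width is below `1 ≤ widthConst`. -/
theorem ucb_sub_lcb_le (p : P) {i : ℕ} (hi : 1 ≤ i) :
    Q.ucb p i - Q.lcb p i ≤ Q.widthConst / Real.sqrt i := by
  match i, hi with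
  | 1, _ =>
    have h1 := Q.lcb_one_pos p
    have h2 := Q.one_le_widthConst
    have h3 : Q.ucb p 1 = 1 := rfl
    rw [h3]
    simp only [Nat.cast_one, Real.sqrt_one, div_one]
    linarith
  | i + 2, _ =>
    rw [← Q.two_mul_radius]
    have h1 : Q.ucb p (i + 2) ≤ Q.mean p (i + 2) + Q.radius (i + 2) := min_le_right _ _
    have h2 : Q.mean p (i + 2) - Q.radius (i + 2) ≤ Q.lcb p (i + 2) := le_max_right _ _
    linarith

/-! ### One phase of continuous eviction -/

variable [DecidableEq P]

/-- The states from which a phase starts are consistent: anti-servers are fractions, the number of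
samples dominates the evicted fraction, and pages that are partly in the cache have been sampled. -/
structure Consistent (S : State P) : Prop where
  y_nonneg : ∀ p, 0 ≤ S.y p
  y_le_one : ∀ p, S.y p ≤ 1
  m_nonneg : ∀ p, 0 ≤ S.m p
  m_le : ∀ p, S.m p ≤ S.N p
  one_le_N : ∀ p, S.y p < 1 → 1 ≤ S.N p

theorem flowY_of_active {q p : P} {S : State P} (h : Active q S p) (s : ℝ) :
    Q.flowY q S s p = (S.y p + Q.eta) * Real.exp (s / Q.lcb p (S.N p)) - Q.eta := if_pos h

theorem flowY_of_not_active {q p : P} {S : State P} (h : ¬ Active q S p) (s : ℝ) :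
    Q.flowY q S s p = S.y p := if_neg h

theorem continuous_flowY (q : P) (S : State P) (p : P) :
    Continuous fun s => Q.flowY q S s p := by
  by_cases h : Active q S p
  · simp only [Q.flowY_of_active h]
    fun_prop
  · simp only [Q.flowY_of_not_active h]
    fun_prop

theorem stopTime_nonneg (q : P) (S : State P) : 0 ≤ Q.stopTime q S :=
  Real.sInf_nonneg fun _ hs => hs.1

variable {Q}

theorem le_flowY {q : P} {S : State P} (hS : Consistent S) {s : ℝ} (hs : 0 ≤ s) (p : P) :
    S.y p ≤ Q.flowY q S s p := by
  by_cases h : Active q S p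
  · rw [Q.flowY_of_active h]
    have h1 : 1 ≤ Real.exp (s / Q.lcb p (S.N p)) :=
      Real.one_le_exp (div_nonneg hs (Q.lcb_nonneg p _))
    nlinarith [Q.eta_pos, hS.y_nonneg p]
  · rw [Q.flowY_of_not_active h]

/-- Existence of a stopping event is not needed: without one the infimum is the default `0`, and no
such `s` exists. -/
theorem not_stop_of_lt {q : P} {S : State P} {s : ℝ} (hs : 0 ≤ s) (h : s < Q.stopTime q S) :
    ∑ p, Q.flowY q S s p < (Q.n : ℝ) - Q.k ∧
      ∀ p, Active q S p → Q.flowY q S s p < 1 ∧ Q.flowM q S s p < S.N p := by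
  have h1 := notMem_of_lt_csInf h ⟨0, fun _ hx => hx.1⟩
  simp only [Set.mem_ofPred_eq, not_and, not_or, not_exists, not_le] at h1
  obtain ⟨h2, h3⟩ := h1 hs
  exact ⟨h2, h3⟩

/-- A weak inequality that holds on `[0, a)`, and at `0`, extends to `a` by continuity. -/
theorem le_at_endpoint {f : ℝ → ℝ} (hf : Continuous f) {a c : ℝ} (ha : 0 ≤ a) (h0 : f 0 ≤ c)
    (h : ∀ s, 0 ≤ s → s < a → f s ≤ c) : f a ≤ c := by
  rcases ha.eq_or_lt with rfl | ha'
  · exact h0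
  · have h1 : closure (Set.Ico 0 a) ⊆ {s | f s ≤ c} :=
      closure_minimal (fun s hs => h s hs.1 hs.2) (isClosed_le hf continuous_const)
    rw [closure_Ico ha'.ne] at h1
    exact h1 ⟨ha, le_rfl⟩

theorem sum_flowY_stopTime_le {q : P} {S : State P} (hf : ¬ Q.Feasible S) :
    ∑ p, Q.flowY q S (Q.stopTime q S) p ≤ (Q.n : ℝ) - Q.k := by
  refine le_at_endpoint (f := fun s => ∑ p, Q.flowY q S s p)
    (continuous_finsetSum _ fun p _ => Q.continuous_flowY q S p) (Q.stopTime_nonneg q S) ?_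
    fun s hs h => (not_stop_of_lt hs h).1.le
  simp only [flowY_zero]
  exact (not_le.1 hf).le

theorem flowY_stopTime_le_one {q : P} {S : State P} (hS : Consistent S) (p : P) :
    Q.flowY q S (Q.stopTime q S) p ≤ 1 := by
  by_cases ha : Active q S p
  · refine le_at_endpoint (Q.continuous_flowY q S p) (Q.stopTime_nonneg q S) ?_
      fun s hs h => ((not_stop_of_lt hs h).2 p ha).1.le
    rw [flowY_zero]
    exact hS.y_le_one p
  · rw [Q.flowY_of_not_active ha]
    exact hS.y_le_one p

theorem flowM_stopTime_le {q : P} {S : State P} (hS : Consistent S) (p : P) :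
    Q.flowM q S (Q.stopTime q S) p ≤ S.N p := by
  by_cases ha : Active q S p
  · refine le_at_endpoint (f := fun s => Q.flowM q S s p) ?_ (Q.stopTime_nonneg q S) ?_
      fun s hs h => ((not_stop_of_lt hs h).2 p ha).2.le
    · have := Q.continuous_flowY q S p
      unfold flowM
      fun_prop
    · simp only [flowM, flowY_zero, sub_self, add_zero]
      exact hS.m_le p
  · rw [flowM, Q.flowY_of_not_active ha, sub_self, add_zero]
    exact hS.m_le p

theorem N_le_phase (q : P) (S : State P) (p : P) : S.N p ≤ (Q.phase q S).N p := by
  simp only [phase]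
  split_ifs <;> omega

theorem Consistent.phase {q : P} {S : State P} (hS : Consistent S) :
    Consistent (Q.phase q S) where
  y_nonneg p := (hS.y_nonneg p).trans (le_flowY hS (Q.stopTime_nonneg q S) p)
  y_le_one p := flowY_stopTime_le_one hS p
  m_nonneg p := by
    have := le_flowY (Q := Q) (q := q) hS (Q.stopTime_nonneg q S) p
    have := hS.m_nonneg p
    simp only [Input.phase, flowM]
    linarith
  m_le p := by
    refine (flowM_stopTime_le hS p).trans ?_
    exact_mod_cast N_le_phase q S p
  one_le_N p hp :=
    (hS.one_le_N p ((le_flowY hS (Q.stopTime_nonneg q S) p).trans_lt hp)).trans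
      (N_le_phase q S p)

theorem phase_y_self (q : P) (S : State P) : (Q.phase q S).y q = S.y q :=
  Q.flowY_of_not_active (fun h => h.1 rfl) _

/-- The potential that compares the anti-servers of the algorithm with those of a schedule. -/
noncomputable def potential (Q : Input P) (z : P → ℝ) (S : State P) : ℝ :=
  ∑ p, z p * (Q.lcb p (S.N p) * Real.log ((1 + Q.eta) / (S.y p + Q.eta)))

/-- The cost of the algorithm, corrected by the potential, by the growth of the lower confidence
bounds and by the accumulated widths of the confidence intervals. -/
noncomputable def energy (Q : Input P) (z : P → ℝ) (S : State P) : ℝ :=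
  S.costUCB + 2 * Q.potential z S - 2 * Real.log (1 + Q.k) * ∑ p, Q.lcb p (S.N p)
    - 2 * Q.widthConst * ∑ p, Real.sqrt (S.m p)

/-- A discrete form of `∫ 1 / √x = 2 * √x`: on `[m, m']` the integrand is at least `1 / √N`. -/
theorem sub_le_sqrt_sub {m m' N : ℝ} (hm : 0 ≤ m) (h : m ≤ m') (hN : m' ≤ N) (hN0 : 0 < N) :
    (m' - m) / Real.sqrt N ≤ 2 * (Real.sqrt m' - Real.sqrt m) := by
  have e : m' - m = (Real.sqrt m' - Real.sqrt m) * (Real.sqrt m' + Real.sqrt m) := by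
    have h1 := Real.sq_sqrt hm
    have h2 := Real.sq_sqrt (hm.trans h)
    linear_combination h1 - h2
  have h3 : Real.sqrt m ≤ Real.sqrt m' := Real.sqrt_le_sqrt h
  have h4 : Real.sqrt m' ≤ Real.sqrt N := Real.sqrt_le_sqrt hN
  rw [div_le_iff₀ (Real.sqrt_pos.2 hN0), e]
  nlinarith

/-- The growth rate `(Y + η) / l` increases along the flow, so the total increase is at most `s`
times the final rate. This is `1 - u ≤ exp (-u)` with `u = s / l`. -/
theorem mul_sub_le_of_exp {l y s η : ℝ} (hl : 0 < l) (hy : 0 ≤ y + η) :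
    l * (((y + η) * Real.exp (s / l) - η) - y) ≤ s * ((y + η) * Real.exp (s / l)) := by
  have h1 : 1 - s / l ≤ Real.exp (-(s / l)) := by linarith [Real.add_one_le_exp (-(s / l))]
  have h2 : (1 - s / l) * Real.exp (s / l) ≤ 1 := by
    calc _ ≤ Real.exp (-(s / l)) * Real.exp (s / l) :=
          mul_le_mul_of_nonneg_right h1 (Real.exp_pos _).le
      _ = 1 := by rw [← Real.exp_add]; simp
  have h3 : (l - s) * Real.exp (s / l) ≤ l := by
    have := mul_le_mul_of_nonneg_left h2 hl.le
    have e : l * ((1 - s / l) * Real.exp (s / l)) = (l - s) * Real.exp (s / l) := by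
      field_simp
    rw [e] at this
    linarith
  nlinarith [mul_le_mul_of_nonneg_left h3 hy]

/-- The contribution of an active page to the cost of a phase. -/
theorem ucb_mul_le_of_active {q p : P} {S : State P} (hS : Consistent S) (ha : Active q S p) :
    Q.ucb p (S.N p) * (Q.flowY q S (Q.stopTime q S) p - S.y p) ≤
      Q.stopTime q S * (Q.flowY q S (Q.stopTime q S) p + Q.eta) +
        2 * Q.widthConst *
          (Real.sqrt (Q.flowM q S (Q.stopTime q S) p) - Real.sqrt (S.m p)) := by
  have hN : 1 ≤ S.N p := hS.one_le_N p ha.2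
  have hl := Q.lcb_pos p hN
  have hy := hS.y_nonneg p
  have hη := Q.eta_pos
  have hd := le_flowY (Q := Q) (q := q) hS (Q.stopTime_nonneg q S) p
  have h1 : Q.lcb p (S.N p) * (Q.flowY q S (Q.stopTime q S) p - S.y p) ≤
      Q.stopTime q S * (Q.flowY q S (Q.stopTime q S) p + Q.eta) := by
    rw [Q.flowY_of_active ha, sub_add_cancel]
    exact mul_sub_le_of_exp hl (by linarith)
  have h2 := sub_le_sqrt_sub (hS.m_nonneg p)
    (by rw [flowM]; linarith : S.m p ≤ Q.flowM q S (Q.stopTime q S) p)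
    (flowM_stopTime_le hS p) (by exact_mod_cast hN)
  have e : Q.flowM q S (Q.stopTime q S) p - S.m p =
      Q.flowY q S (Q.stopTime q S) p - S.y p := by rw [flowM]; ring
  rw [e] at h2
  have h3 := mul_le_mul_of_nonneg_right (Q.ucb_sub_lcb_le p hN) (sub_nonneg.2 hd)
  have h4 := mul_le_mul_of_nonneg_left h2 (zero_le_one.trans Q.one_le_widthConst)
  have e2 : Q.widthConst / Real.sqrt (S.N p) * (Q.flowY q S (Q.stopTime q S) p - S.y p) =
      Q.widthConst * ((Q.flowY q S (Q.stopTime q S) p - S.y p) / Real.sqrt (S.N p)) := by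
    ring
  rw [e2] at h3
  linarith

theorem log_ratio_flowY {q p : P} {S : State P} (hS : Consistent S) (ha : Active q S p) (s : ℝ) :
    Q.lcb p (S.N p) * Real.log ((1 + Q.eta) / (Q.flowY q S s p + Q.eta)) =
      Q.lcb p (S.N p) * Real.log ((1 + Q.eta) / (S.y p + Q.eta)) - s := by
  have hl := Q.lcb_pos p (hS.one_le_N p ha.2)
  have hy := hS.y_nonneg p
  have hη := Q.eta_pos
  have h1 : S.y p + Q.eta ≠ 0 := by positivity
  have h2 : (1 : ℝ) + Q.eta ≠ 0 := by positivity
  rw [Q.flowY_of_active ha, sub_add_cancel, Real.log_div h2 (by positivity),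
    Real.log_div h2 h1, Real.log_mul h1 (Real.exp_pos _).ne', Real.log_exp]
  field_simp
  ring

/-- As long as the algorithm is infeasible, a feasible schedule has at least half of the
(shifted) anti-server of the algorithm on the active pages. -/
theorem sum_active_le {q : P} {S : State P} (hS : Consistent S) (hq : S.y q = 0)
    (hf : ¬ Q.Feasible S) {z : P → ℝ} (hz : ∀ p, z p ∈ Set.Icc (0 : ℝ) 1)
    (hzs : (Q.n : ℝ) - Q.k ≤ ∑ p, z p) (hzq : z q = 0) :
    ∑ p with Active q S p, (Q.flowY q S (Q.stopTime q S) p + Q.eta) ≤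
      2 * ∑ p with Active q S p, z p := by
  have hY := sum_flowY_stopTime_le (q := q) hf
  have hy := not_le.1 hf
  have split : ∀ f : P → ℝ,
      ∑ p, f p = ∑ p with Active q S p, f p + ∑ p with ¬ Active q S p, f p :=
    fun f => (Finset.sum_filter_add_sum_filter_not _ _ _).symm
  have hmem : q ∈ Finset.univ.filter fun p => ¬ Active q S p := by simp [Active]
  have hn : (Q.n : ℝ) = (Finset.univ.filter fun p => Active q S p).card +
      (Finset.univ.filter fun p => ¬ Active q S p).card := by
    rw [n, ← Finset.card_univ]
    exact_mod_cast (Finset.card_filter_add_card_filter_not _).symm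
  have hone : ∑ p with ¬ Active q S p, (1 - if p = q then (1 : ℝ) else 0) =
      (Finset.univ.filter fun p => ¬ Active q S p).card - 1 := by
    rw [Finset.sum_sub_distrib, Finset.sum_ite_eq', if_pos hmem]
    simp
  have hyB : ∑ p with ¬ Active q S p, S.y p =
      (Finset.univ.filter fun p => ¬ Active q S p).card - 1 := by
    rw [← hone]
    refine Finset.sum_congr rfl fun p hp => ?_
    by_cases hpq : p = q
    · simp [hpq, hq]
    · have : ¬ S.y p < 1 := fun h => (Finset.mem_filter.1 hp).2 ⟨hpq, h⟩
      simp [hpq, le_antisymm (hS.y_le_one p) (not_lt.1 this)]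
  have hYB : ∑ p with ¬ Active q S p, Q.flowY q S (Q.stopTime q S) p =
      (Finset.univ.filter fun p => ¬ Active q S p).card - 1 := by
    rw [← hyB]
    exact Finset.sum_congr rfl fun p hp =>
      Q.flowY_of_not_active (Finset.mem_filter.1 hp).2 _
  have hzB : ∑ p with ¬ Active q S p, z p ≤
      (Finset.univ.filter fun p => ¬ Active q S p).card - 1 := by
    rw [← hone]
    refine Finset.sum_le_sum fun p _ => ?_
    by_cases hpq : p = q
    · simp [hpq, hzq]
    · simpa [hpq] using (hz p).2
  have hyA : 0 ≤ ∑ p with Active q S p, S.y p := Finset.sum_nonneg fun p _ => hS.y_nonneg p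
  rw [split] at hY hy hzs
  rw [Finset.sum_add_distrib, Finset.sum_const, nsmul_eq_mul]
  set a := (Finset.univ.filter fun p => Active q S p).card
  -- The inactive pages are `q` with value `0` and pages with value `1`. So `a + 1 - k` bounds the
  -- active sum of the flow from above and that of `z` from below, and strict infeasibility makes it
  -- positive.
  have hak : Q.k ≤ a := by
    have : (Q.k : ℝ) < a + 1 := by linarith
    exact Nat.lt_succ_iff.1 (by exact_mod_cast this)
  have hk1 : (1 : ℝ) ≤ Q.k := by exact_mod_cast Q.one_le_k
  have hak' : (Q.k : ℝ) ≤ a := by exact_mod_cast hak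
  -- Equivalent to `(k - 1) * (a - k) ≥ 0`: the shifts add at most another `a + 1 - k`, hence the
  -- factor `2`.
  have ha : (a : ℝ) * Q.eta ≤ a + 1 - Q.k := by
    rw [eta, mul_one_div, div_le_iff₀ (by linarith)]
    nlinarith
  linarith

theorem energy_phase_le {q : P} {S : State P} (hS : Consistent S) (hq : S.y q = 0)
    (hf : ¬ Q.Feasible S) {z : P → ℝ} (hz : ∀ p, z p ∈ Set.Icc (0 : ℝ) 1)
    (hzs : (Q.n : ℝ) - Q.k ≤ ∑ p, z p) (hzq : z q = 0) :
    Q.energy z (Q.phase q S) ≤ Q.energy z S := by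
  have hS' : Consistent (Q.phase q S) := hS.phase
  -- the confidence bounds may be replaced by the ones at the start of the phase
  have hN : ∀ p, z p * (Q.lcb p ((Q.phase q S).N p) *
        Real.log ((1 + Q.eta) / ((Q.phase q S).y p + Q.eta))) -
        Real.log (1 + Q.k) * Q.lcb p ((Q.phase q S).N p) ≤
      z p * (Q.lcb p (S.N p) * Real.log ((1 + Q.eta) / ((Q.phase q S).y p + Q.eta))) -
        Real.log (1 + Q.k) * Q.lcb p (S.N p) := by
    intro p
    have h1 := Q.lcb_mono p (N_le_phase (Q := Q) q S p)
    have h2 := Q.log_ratio_le (hS'.y_nonneg p)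
    have h3 := Q.log_ratio_nonneg (hS'.y_nonneg p) (hS'.y_le_one p)
    -- Hence the coefficient of `lcb` in the difference is nonpositive, and raising `lcb` only
    -- lowers it.
    have h4 : z p * Real.log ((1 + Q.eta) / ((Q.phase q S).y p + Q.eta)) ≤
        Real.log (1 + Q.k) := (mul_le_of_le_one_left h3 (hz p).2).trans h2
    nlinarith
  have hpage : ∀ p, Q.ucb p (S.N p) * ((Q.phase q S).y p - S.y p) +
        2 * (z p * (Q.lcb p (S.N p) *
          Real.log ((1 + Q.eta) / ((Q.phase q S).y p + Q.eta)))) -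
        2 * Q.widthConst * Real.sqrt ((Q.phase q S).m p) ≤
      (2 * (z p * (Q.lcb p (S.N p) * Real.log ((1 + Q.eta) / (S.y p + Q.eta)))) -
        2 * Q.widthConst * Real.sqrt (S.m p)) +
      if Active q S p then
        Q.stopTime q S * ((Q.flowY q S (Q.stopTime q S) p + Q.eta) - 2 * z p) else 0 := by
    intro p
    by_cases ha : Active q S p
    · have h1 := ucb_mul_le_of_active (Q := Q) hS ha
      rw [if_pos ha]
      simp only [phase]
      rw [log_ratio_flowY hS ha]
      linarith
    · rw [if_neg ha]
      simp only [phase, flowM, Q.flowY_of_not_active ha, sub_self, add_zero, mul_zero, zero_add,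
        le_refl]
  have hA : ∑ p, (if Active q S p then
      Q.stopTime q S * ((Q.flowY q S (Q.stopTime q S) p + Q.eta) - 2 * z p) else 0) ≤ 0 := by
    rw [← Finset.sum_filter, ← Finset.mul_sum, Finset.sum_sub_distrib, ← Finset.mul_sum]
    exact mul_nonpos_of_nonneg_of_nonpos (Q.stopTime_nonneg q S)
      (sub_nonpos.2 (sum_active_le hS hq hf hz hzs hzq))
  have s1 := Finset.sum_le_sum fun p (_ : p ∈ Finset.univ) => hN p
  have s2 := Finset.sum_le_sum fun p (_ : p ∈ Finset.univ) => hpage p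
  simp only [Finset.sum_add_distrib, Finset.sum_sub_distrib, ← Finset.mul_sum] at s1 s2
  have hc : (Q.phase q S).costUCB =
      S.costUCB + ∑ p, Q.ucb p (S.N p) * ((Q.phase q S).y p - S.y p) := rfl
  rw [energy, energy, potential, potential, hc]
  linarith

/-! ### One request -/

theorem Consistent.fetch {q : P} {S : State P} (hS : Consistent S) : Consistent (fetch q S) where
  y_nonneg p := by
    by_cases h : p = q
    · simp [Input.fetch, h]
    · simpa [Input.fetch, h] using hS.y_nonneg p
  y_le_one p := by
    by_cases h : p = q
    · simp [Input.fetch, h]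
    · simpa [Input.fetch, h] using hS.y_le_one p
  m_nonneg := hS.m_nonneg
  m_le p := by
    refine (hS.m_le p).trans ?_
    simp only [Input.fetch]
    split_ifs with h
    · by_cases hp : p = q
      · simp [hp, h]
      · simp [hp]
    · exact le_rfl
  one_le_N p hp := by
    simp only [Input.fetch] at hp ⊢
    by_cases h : p = q
    · subst h
      split_ifs with h0
      · simp
      · omega
    · have := hS.one_le_N p (by simpa [h] using hp)
      split_ifs with h0
      · simpa [h] using this
      · exact this

theorem N_le_fetch (q : P) (S : State P) (p : P) : S.N p ≤ (fetch q S).N p := by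
  simp only [fetch]
  split_ifs with h
  · by_cases hp : p = q
    · simp [hp, h]
    · simp [hp]
  · exact le_rfl

theorem fetch_y_self (q : P) (S : State P) : (fetch q S).y q = 0 := by simp [fetch]

/-- The potential ignores `q` because `z q = 0`, so neither the drop of `y q` nor a first sample
affects it; a larger `lcb` enters the energy negatively. -/
theorem energy_fetch_le {q : P} {S : State P} {z : P → ℝ} (hzq : z q = 0) :
    Q.energy z (fetch q S) ≤ Q.energy z S := by
  have h1 : Q.potential z (fetch q S) = Q.potential z S := by
    refine Finset.sum_congr rfl fun p _ => ?_
    by_cases hp : p = q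
    · simp [hp, hzq]
    · have hN : (fetch q S).N p = S.N p := by
        simp only [fetch]
        split_ifs <;> simp [hp]
      rw [hN]
      simp [fetch, hp]
  have h2 : ∑ p, Q.lcb p (S.N p) ≤ ∑ p, Q.lcb p ((fetch q S).N p) :=
    Finset.sum_le_sum fun p _ => Q.lcb_mono p (N_le_fetch q S p)
  have h3 := mul_le_mul_of_nonneg_left h2
    (mul_nonneg zero_le_two Q.log_one_add_k_nonneg)
  rw [energy, energy, h1]
  have h4 : (fetch q S).costUCB = S.costUCB := rfl
  have h5 : (fetch q S).m = S.m := rfl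
  rw [h4, h5]
  linarith

/-- A property that holds after fetching and is preserved by the phases that start in an
infeasible state holds after the request. -/
theorem serve_induction {q : P} {S : State P} {p : State P → Prop} (h0 : p (fetch q S))
    (h1 : ∀ S', ¬ Q.Feasible S' → p S' → p (Q.phase q S')) : p (Q.serve q S) := by
  -- Every index below the infimum is infeasible, even if the set is empty and the infimum is `0`;
  -- termination plays no role.
  have key : ∀ j, j ≤ sInf {j : ℕ | Q.Feasible ((Q.phase q)^[j] (fetch q S))} →
      p ((Q.phase q)^[j] (fetch q S)) := by
    intro j
    induction j with
    | zero => exact fun _ => h0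
    | succ j ih =>
      intro hj
      rw [Function.iterate_succ_apply']
      exact h1 _ (Nat.notMem_of_lt_sInf hj) (ih (Nat.le_of_succ_le hj))
  exact key _ le_rfl

theorem Consistent.serve {q : P} {S : State P} (hS : Consistent S) :
    Consistent (Q.serve q S) :=
  serve_induction hS.fetch fun _ _ h => h.phase

theorem N_le_serve (q : P) (S : State P) (p : P) : S.N p ≤ (Q.serve q S).N p :=
  serve_induction (p := fun S' => S.N p ≤ S'.N p) (N_le_fetch q S p)
    fun S' _ h => h.trans (N_le_phase q S' p)

theorem energy_serve_le {q : P} {S : State P} (hS : Consistent S) {z : P → ℝ}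
    (hz : ∀ p, z p ∈ Set.Icc (0 : ℝ) 1) (hzs : (Q.n : ℝ) - Q.k ≤ ∑ p, z p) (hzq : z q = 0) :
    Q.energy z (Q.serve q S) ≤ Q.energy z S := by
  refine (serve_induction (Q := Q) (q := q) (S := S)
    (p := fun S' => Consistent S' ∧ S'.y q = 0 ∧ Q.energy z S' ≤ Q.energy z S)
    ⟨hS.fetch, fetch_y_self q S, energy_fetch_le hzq⟩ ?_).2.2
  rintro S' hf ⟨h1, h2, h3⟩
  exact ⟨h1.phase, (phase_y_self q S').trans h2, (energy_phase_le h1 h2 hf hz hzs hzq).trans h3⟩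

/-- Eviction raises `m` and `y` equally, so only the fetch changes `m - y`, by the old `y q ≤ 1`. -/
theorem sum_m_sub_y_serve_le {q : P} {S : State P} (hS : Consistent S) :
    ∑ p, ((Q.serve q S).m p - (Q.serve q S).y p) ≤ ∑ p, (S.m p - S.y p) + 1 := by
  refine serve_induction (Q := Q) (q := q) (S := S)
    (p := fun S' => ∑ p, (S'.m p - S'.y p) ≤ ∑ p, (S.m p - S.y p) + 1) ?_ ?_
  · have h : ∑ p, (if p = q then (1 : ℝ) else 0) = 1 := by simp
    rw [← h, ← Finset.sum_add_distrib]
    refine Finset.sum_le_sum fun p _ => ?_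
    by_cases hp : p = q
    · subst hp
      simp only [fetch, Function.update_self, if_true]
      linarith [hS.y_le_one p]
    · simp [fetch, hp]
  · intro S' _ h
    refine (Finset.sum_congr rfl fun p _ => ?_).trans_le h
    simp only [phase, flowM]
    ring

/-- The assumption concerns only the latest upper bounds; these decrease over time, so it covers
every earlier charge. -/
theorem cost_le_costUCB_serve {q : P} {S : State P} (hS : Consistent S)
    (h : (∀ p, Q.w p ≤ Q.ucb p (S.N p)) → S.cost ≤ S.costUCB) :
    (∀ p, Q.w p ≤ Q.ucb p ((Q.serve q S).N p)) →
      (Q.serve q S).cost ≤ (Q.serve q S).costUCB := by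
  refine (serve_induction (Q := Q) (q := q) (S := S) (p := fun S' => Consistent S' ∧
    ((∀ p, Q.w p ≤ Q.ucb p (S'.N p)) → S'.cost ≤ S'.costUCB)) ⟨hS.fetch, fun hw => ?_⟩ ?_).2
  · exact h fun p => (hw p).trans (Q.ucb_anti p (N_le_fetch q S p))
  · rintro S' _ ⟨h1, h2⟩
    refine ⟨h1.phase, fun hw => ?_⟩
    have hw' : ∀ p, Q.w p ≤ Q.ucb p (S'.N p) :=
      fun p => (hw p).trans (Q.ucb_anti p (N_le_phase q S' p))
    exact add_le_add (h2 hw') (Finset.sum_le_sum fun p _ =>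
      mul_le_mul_of_nonneg_right (hw' p)
        (sub_nonneg.2 (le_flowY h1 (Q.stopTime_nonneg q S') p)))

/-! ### The whole run -/

theorem consistent_run (t : ℕ) : Consistent (Q.run t) := by
  induction t with
  | zero => constructor <;> simp [run, init]
  | succ t ih => exact ih.serve

theorem N_run_mono (p : P) : Monotone fun t => (Q.run t).N p :=
  monotone_nat_of_le_succ fun t => N_le_serve (Q.req t) (Q.run t) p

theorem sum_m_sub_y_run_le (t : ℕ) : ∑ p, ((Q.run t).m p - (Q.run t).y p) ≤ t - Q.n := by
  induction t with
  | zero => simp [run, init, n]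
  | succ t ih =>
    have := sum_m_sub_y_serve_le (Q := Q) (q := Q.req t) (consistent_run (Q := Q) t)
    rw [run]
    push_cast
    linarith

theorem sum_m_run_le (t : ℕ) : ∑ p, (Q.run t).m p ≤ t := by
  have h1 := sum_m_sub_y_run_le (Q := Q) t
  have h2 : ∑ p, (Q.run t).y p ≤ ∑ _p : P, (1 : ℝ) :=
    Finset.sum_le_sum fun p _ => (consistent_run t).y_le_one p
  have h3 : ∑ _p : P, (1 : ℝ) = Q.n := by simp [n]
  rw [Finset.sum_sub_distrib] at h1
  linarith

theorem sum_sqrt_m_run_le (t : ℕ) :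
    ∑ p, Real.sqrt ((Q.run t).m p) ≤ Real.sqrt ((Q.n : ℝ) * t) := by
  apply Real.le_sqrt_of_sq_le
  refine sq_sum_le_card_mul_sum_sq.trans ?_
  rw [Finset.card_univ]
  refine mul_le_mul_of_nonneg_left ?_ (Nat.cast_nonneg _)
  refine le_trans (le_of_eq ?_) (sum_m_run_le (Q := Q) t)
  exact Finset.sum_congr rfl fun p _ => Real.sq_sqrt ((consistent_run t).m_nonneg p)

theorem GoodEvent.le_ucb (h : Q.GoodEvent) (p : P) : Q.w p ≤ Q.ucb p ((Q.run Q.T).N p) := by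
  rcases Nat.eq_zero_or_pos ((Q.run Q.T).N p) with h0 | h0
  · rw [h0]
    exact (Q.w_mem p).2
  · exact (h p _ h0 le_rfl).2

theorem GoodEvent.lcb_le (h : Q.GoodEvent) (p : P) {t : ℕ} (ht : t ≤ Q.T) :
    Q.lcb p ((Q.run t).N p) ≤ Q.w p := by
  rcases Nat.eq_zero_or_pos ((Q.run t).N p) with h0 | h0
  · rw [h0]
    exact (Q.w_mem p).1.le
  · exact (h p _ h0 (N_run_mono p ht)).1

theorem GoodEvent.onf_le_onfUCB (h : Q.GoodEvent) : Q.onf ≤ Q.onfUCB := by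
  have key : ∀ t, (∀ p, Q.w p ≤ Q.ucb p ((Q.run t).N p)) →
      (Q.run t).cost ≤ (Q.run t).costUCB := by
    intro t
    induction t with
    | zero => simp [run, init]
    | succ t ih => exact cost_le_costUCB_serve (consistent_run t) ih
  exact key Q.T h.le_ucb

/-- The coefficient of `z p` in the potential lies between `0` and `w p * log (1 + k)`, so decreases
of `z p` are free. -/
theorem energy_move_le {S : State P} (hS : Consistent S) (hw : ∀ p, Q.lcb p (S.N p) ≤ Q.w p)
    (z z' : P → ℝ) :
    Q.energy z' S ≤
      Q.energy z S + 2 * Real.log (1 + Q.k) * ∑ p, Q.w p * max 0 (z' p - z p) := by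
  have h : Q.potential z' S ≤ Q.potential z S +
      Real.log (1 + Q.k) * ∑ p, Q.w p * max 0 (z' p - z p) := by
    rw [potential, potential, Finset.mul_sum, ← Finset.sum_add_distrib]
    refine Finset.sum_le_sum fun p _ => ?_
    have h1 := Q.log_ratio_le (hS.y_nonneg p)
    have h2 := Q.log_ratio_nonneg (hS.y_nonneg p) (hS.y_le_one p)
    have h3 : Q.lcb p (S.N p) * Real.log ((1 + Q.eta) / (S.y p + Q.eta)) ≤
        Q.w p * Real.log (1 + Q.k) :=
      mul_le_mul (hw p) h1 h2 (Q.w_mem p).1.le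
    have h4 := mul_nonneg (Q.lcb_nonneg p (S.N p)) h2
    have h5 := mul_le_mul_of_nonneg_right (le_max_right 0 (z' p - z p)) h4
    have h6 := mul_le_mul_of_nonneg_left h3 (le_max_left 0 (z' p - z p))
    linarith
  rw [energy, energy]
  linarith

theorem GoodEvent.energy_run_le (h : Q.GoodEvent) {z : ℕ → P → ℝ} (hz : Q.IsFracSchedule z)
    {t : ℕ} (ht : t ≤ Q.T) :
    Q.energy (z t) (Q.run t) ≤ 2 * Real.log (1 + Q.k) *
      ∑ u ∈ Finset.range t, ∑ p, Q.w p * max 0 (z (u + 1) p - z u p) := by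
  induction t with
  | zero =>
    have h1 : (1 + Q.eta) / (1 + Q.eta) = 1 := div_self (by linarith [Q.eta_pos])
    simp [energy, potential, run, init, h1, lcb]
  | succ t ih =>
    obtain ⟨hz1, hz2, hz3⟩ := hz.2 t ht
    -- The schedule moves first; the algorithm then serves against `z (t + 1)`, which already
    -- vanishes at the request.
    have h1 := energy_serve_le (consistent_run (Q := Q) t) hz1 hz2 hz3
    have h2 := energy_move_le (consistent_run (Q := Q) t)
      (fun p => h.lcb_le p (Nat.le_of_succ_le ht)) (z t) (z (t + 1))
    have h3 := ih (Nat.le_of_succ_le ht)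
    rw [Finset.sum_range_succ, run]
    linarith

theorem GoodEvent.onfUCB_le_fracScheduleCost (h : Q.GoodEvent) {z : ℕ → P → ℝ}
    (hz : Q.IsFracSchedule z) :
    Q.onfUCB ≤ 2 * Real.log (1 + Q.k) * Q.fracScheduleCost z +
      8 * (Real.sqrt ((Q.n : ℝ) * Q.T) * Real.log ((Q.n : ℝ) * Q.T)) := by
  have hE := h.energy_run_le hz le_rfl
  have hC := consistent_run (Q := Q) Q.T
  have hz0 : ∀ p, 0 ≤ z Q.T p := by
    intro p
    rcases hT : Q.T with _ | t
    · simp [hz.1]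
    · exact ((hz.2 t (by omega)).1 p).1
  have hpot : 0 ≤ Q.potential (z Q.T) (Q.run Q.T) :=
    Finset.sum_nonneg fun p _ => mul_nonneg (hz0 p) (mul_nonneg (Q.lcb_nonneg p _)
      (Q.log_ratio_nonneg (hC.y_nonneg p) (hC.y_le_one p)))
  have hn : (0 : ℝ) ≤ Q.n := Nat.cast_nonneg _
  have hlog := Q.one_le_log_n_mul_T
  have hnT : (Q.n : ℝ) ≤ Real.sqrt ((Q.n : ℝ) * Q.T) := by
    apply Real.le_sqrt_of_sq_le
    rw [sq]
    exact mul_le_mul_of_nonneg_left (by exact_mod_cast Q.n_le_T) hn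
  have hlcb : ∑ p, Q.lcb p ((Q.run Q.T).N p) ≤ Real.sqrt ((Q.n : ℝ) * Q.T) := by
    refine le_trans ?_ hnT
    calc _ ≤ ∑ _p : P, (1 : ℝ) :=
          Finset.sum_le_sum fun p _ => (h.lcb_le p le_rfl).trans (Q.w_mem p).2
      _ = Q.n := by simp [n]
  have hk : Real.log (1 + (Q.k : ℝ)) ≤ Real.log ((Q.n : ℝ) * Q.T) := by
    have h1 : (1 : ℝ) + Q.k ≤ Q.n := by
      have := Q.k_lt
      rw [n]
      exact_mod_cast (by omega : 1 + Q.k ≤ Fintype.card P)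
    have h2 : (1 : ℝ) ≤ Q.T := by
      exact_mod_cast (by have := Q.two_le_n; have := Q.n_le_T; omega : 1 ≤ Q.T)
    apply Real.log_le_log (by positivity)
    nlinarith
  have hs := Real.sqrt_nonneg ((Q.n : ℝ) * Q.T)
  have b1 : Real.log (1 + (Q.k : ℝ)) * ∑ p, Q.lcb p ((Q.run Q.T).N p) ≤
      Real.log ((Q.n : ℝ) * Q.T) * Real.sqrt ((Q.n : ℝ) * Q.T) :=
    mul_le_mul hk hlcb (Finset.sum_nonneg fun p _ => Q.lcb_nonneg p _) (by linarith)
  have b2 : Q.widthConst * ∑ p, Real.sqrt ((Q.run Q.T).m p) ≤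
      3 * Real.log ((Q.n : ℝ) * Q.T) * Real.sqrt ((Q.n : ℝ) * Q.T) :=
    mul_le_mul Q.widthConst_le (sum_sqrt_m_run_le Q.T)
      (Finset.sum_nonneg fun p _ => Real.sqrt_nonneg _) (by linarith)
  rw [energy] at hE
  rw [onfUCB, fracScheduleCost]
  -- The constant is `8 = 2 * 1 + 2 * 3`, from `b1` and `b2`.
  linarith

/-! ### Comparison of the offline optima -/

variable (Q) in
theorem exists_isCacheSchedule : ∃ C, Q.IsCacheSchedule C := by
  refine ⟨fun t => match t with
    | 0 => ∅
    | t + 1 => {Q.req t}, rfl, fun t _ => ⟨?_, ?_⟩⟩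
  · simpa using Q.one_le_k
  · simp

/-- The fractional schedule of a cache schedule has the same cost. -/
theorem IsCacheSchedule.exists_isFracSchedule {C : ℕ → Finset P} (hC : Q.IsCacheSchedule C) :
    ∃ z, Q.IsFracSchedule z ∧ Q.fracScheduleCost z = Q.scheduleCost C := by
  refine ⟨fun t p => if p ∈ C t then 0 else 1, ⟨fun p => by simp [hC.1], fun t ht => ?_⟩, ?_⟩
  · obtain ⟨h1, h2⟩ := hC.2 t ht
    refine ⟨fun p => ?_, ?_, if_pos h2⟩
    · dsimp only
      split_ifs <;> simp
    · have e : ∑ p, (if p ∈ C (t + 1) then (0 : ℝ) else 1) = Q.n - (C (t + 1)).card := by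
        have : ∀ p, (if p ∈ C (t + 1) then (0 : ℝ) else 1) =
            1 - if p ∈ C (t + 1) then 1 else 0 := fun p => by split_ifs <;> simp
        simp [this, n]
      rw [e]
      have : ((C (t + 1)).card : ℝ) ≤ Q.k := by exact_mod_cast h1
      linarith
  · refine Finset.sum_congr rfl fun t _ => ?_
    rw [← Finset.sum_subset (Finset.subset_univ (C t \ C (t + 1)))]
    · refine Finset.sum_congr rfl fun p hp => ?_
      obtain ⟨h1, h2⟩ := Finset.mem_sdiff.1 hp
      simp [h1, h2]
    · intro p _ hp
      have : p ∈ C t → p ∈ C (t + 1) := by simpa using hp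
      by_cases h1 : p ∈ C t
      · simp [h1, this h1]
      · by_cases h2 : p ∈ C (t + 1) <;> simp [h1, h2]

theorem fracScheduleCost_nonneg (z : ℕ → P → ℝ) : 0 ≤ Q.fracScheduleCost z :=
  Finset.sum_nonneg fun _ _ => Finset.sum_nonneg fun p _ =>
    mul_nonneg (Q.w_mem p).1.le (le_max_left _ _)

theorem fracOpt_nonneg : 0 ≤ Q.fracOpt :=
  Real.sInf_nonneg (by
    rintro _ ⟨z, _, rfl⟩
    exact fracScheduleCost_nonneg z)

theorem fracOpt_le_opt : Q.fracOpt ≤ Q.opt := by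
  obtain ⟨C₀, hC₀⟩ := Q.exists_isCacheSchedule
  refine le_csInf ⟨_, C₀, hC₀, rfl⟩ ?_
  rintro _ ⟨C, hC, rfl⟩
  obtain ⟨z, hz, e⟩ := hC.exists_isFracSchedule
  refine csInf_le ⟨0, ?_⟩ ⟨z, hz, e.symm⟩
  rintro _ ⟨z', _, rfl⟩
  exact fracScheduleCost_nonneg z'

theorem GoodEvent.onfUCB_le_fracOpt (h : Q.GoodEvent) :
    Q.onfUCB ≤ 2 * Real.log (1 + Q.k) * Q.fracOpt +
      8 * (Real.sqrt ((Q.n : ℝ) * Q.T) * Real.log ((Q.n : ℝ) * Q.T)) := by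
  have hk : 0 < Real.log (1 + (Q.k : ℝ)) :=
    Real.log_pos (by have : (1 : ℝ) ≤ Q.k := by exact_mod_cast Q.one_le_k
                     linarith)
  have hk2 : 0 < 2 * Real.log (1 + (Q.k : ℝ)) := mul_pos two_pos hk
  -- Isolating `fracOpt` lets the bound for each schedule pass to the infimum.
  rw [← sub_le_iff_le_add, ← div_le_iff₀' hk2]
  obtain ⟨C₀, hC₀⟩ := Q.exists_isCacheSchedule
  obtain ⟨z₀, hz₀, _⟩ := hC₀.exists_isFracSchedule
  refine le_csInf ⟨_, z₀, hz₀, rfl⟩ ?_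
  rintro _ ⟨z, hz, rfl⟩
  rw [div_le_iff₀' hk2, sub_le_iff_le_add]
  exact h.onfUCB_le_fracScheduleCost hz

end Input

end FracPaging

theorem mainTheorem2 :
    ∃ C : ℝ, 0 < C ∧
      ∀ (P : Type*) [Fintype P] [DecidableEq P] (Q : FracPaging.Input P), Q.GoodEvent →
        Q.onf ≤ Q.onfUCB ∧
        Q.onfUCB ≤ C * Real.log (1 + (Q.k : ℝ)) * Q.fracOpt
          + C * (Real.sqrt ((Q.n : ℝ) * Q.T) * Real.log ((Q.n : ℝ) * Q.T)) ∧
        Q.onfUCB ≤ C * Real.log (1 + (Q.k : ℝ)) * Q.opt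
          + C * (Real.sqrt ((Q.n : ℝ) * Q.T) * Real.log ((Q.n : ℝ) * Q.T)) := by
  -- The additive term requires `8`; the factor `2` of the optimum may be enlarged to it since
  -- `fracOpt` is nonnegative.
  refine ⟨8, by norm_num, fun P _ _ Q h => ?_⟩
  have hk := Q.log_one_add_k_nonneg
  have h1 := h.onfUCB_le_fracOpt
  have h2 := mul_nonneg hk (FracPaging.Input.fracOpt_nonneg (Q := Q))
  have h3 := mul_le_mul_of_nonneg_left (FracPaging.Input.fracOpt_le_opt (Q := Q)) hk
  refine ⟨h.onf_le_onfUCB, ?_, ?_⟩ <;> linarith
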